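/- Let $\omega_1,\omega_2\in\mathbb C$ with $\tau:=\omega_2/\omega_1$ in the upper half plane, $\Lambda=2\omega_1\mathbb Z+2\omega_2\mathbb Z$, let $\sigma(z)=z\prod_{l\in\Lambda\setminus\{0\}}(1-\tfrac zl)\,e^{z/l+z^2/(2l^2)}$ be the Weierstrass sigma function of $\Lambda$, $\zeta=\sigma'/\sigma$, $\eta_1=\zeta(\omega_1)$, and $\theta_1(z)=\sum_{k\in\mathbb Z}\exp\big[2\pi i\big((z+\tfrac12)(k+\tfrac12)+\tfrac12(k+\tfrac12)^2\tau\big)\big]$. Let $\sigma_0=\sigma$ and $\sigma_r(z)=e^{-\zeta(\rho_r)z}\sigma(z+\rho_r)/\sigma(\rho_r)$ for $r=1,2,3$, with the half periods $\rho_1=\omega_1$, $\rho_2=-\omega_1-\omega_2$, $\rho_3=\omega_2$. For $\hbar\in\mathbb C$ define operators on functions $f$ of $(\lambda_1,\lambda_2)\in\mathbb C^2$, with $T_{\pm1}^{a}$, $T_{\pm2}^{a}$ denoting the shift of the first, resp. second, variable by $\pm a$: $$\widetilde M_1=\sum_{\epsilon=\pm1}\ \prod_{\delta=\pm1}\frac{\theta_1(\epsilon\lambda_1+\delta\lambda_2-\hbar)}{\theta_1(\epsilon\lambda_1+\delta\lambda_2)}\,T^{\hbar}_{\epsilon1}+\sum_{\epsilon=\pm1}\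 \prod_{\delta=\pm1}\frac{\theta_1(\epsilon\lambda_2+\delta\lambda_1-\hbar)}{\theta_1(\epsilon\lambda_2+\delta\lambda_1)}\,T^{\hbar}_{\epsilon2},$$ $$\widetilde M_2=\sum_{\epsilon,\delta=\pm1}\left(\frac{\theta_1(z_{\epsilon\delta}-\hbar)}{\theta_1(z_{\epsilon\delta}+\hbar)}\,T^{\hbar}_{\epsilon1}T^{\hbar}_{\delta2}+\frac{\theta_1(z_{\epsilon\delta}-\hbar)\,\theta_1(z_{\epsilon\delta}+2\hbar)}{\theta_1(z_{\epsilon\delta})\,\theta_1(z_{\epsilon\delta}+\hbar)}\right),\qquad z_{\epsilon\delta}=\epsilon\lambda_1+\delta\lambda_2 .$$ For complex parameters $\gamma,\mu,\mu_r,\mu_r'$ $(r=0,1,2,3)$ put, as meromorphic functions, $v(z)=\sigma(z+\mu)/\sigma(z)$ and $w(z)=\prod_{r=0}^3\frac{\sigma_r(z+\mu_r)\,\sigma_r(z+\mu_r'+\gamma/2)}{\sigma_r(z)\,\sigma_r(z+\gamma/2)}$, and $$A_1=\sum_{\epsilon=\pm1}w(\epsilon x_1)v(\epsilon x_1+x_2)v(\epsilon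 x_1-x_2)T^\gamma_{\epsilon1},\qquad A_2=\sum_{\epsilon=\pm1}w(\epsilon x_2)v(\epsilon x_2+x_1)v(\epsilon x_2-x_1)T^\gamma_{\epsilon2}.$$ Van Diejen's operators are $\mathcal H_1=A_1+A_2+U_{\{1,2\},1}$ and $$\mathcal H_2=\sum_{\epsilon,\delta=\pm1}w(\epsilon x_1)w(\delta x_2)v(\epsilon x_1+\delta x_2)v(\epsilon x_1+\delta x_2+\gamma)T^\gamma_{\epsilon1}T^\gamma_{\delta2}+U_{\{2\},1}A_1+U_{\{1\},1}A_2+U_{\{1,2\},2},$$ where $U_{\{j\},1}=-w(x_j)-w(-x_j)$, $$U_{\{1,2\},1}=\sum_{r=0}^3c_r\prod_{j=1,2}\frac{\sigma_r(\mu-\gamma/2+x_j)\,\sigma_r(\mu-\gamma/2-x_j)}{\sigma_r(-\gamma/2+x_j)\,\sigma_r(-\gamma/2-x_j)},\qquad c_r=\frac{2}{\sigma(\mu)\sigma(\mu-\gamma)}\prod_{s=0}^3\sigma_s(\mu_{\pi_r(s)}-\gamma/2)\,\sigma_s(\mu'_{\pi_r(s)}),$$ $$U_{\{1,2\},2}=\sum_{\epsilon,\delta=\pm1}w(\epsilon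 x_1)w(\delta x_2)v(\epsilon x_1+\delta x_2)v(-\epsilon x_1-\delta x_2-\gamma),$$ with $\pi_0=\mathrm{id}$, $\pi_1=(01)(23)$, $\pi_2=(02)(13)$, $\pi_3=(03)(12)$. Let $\bar{\mathcal H}_1,\bar{\mathcal H}_2$ be the specializations of $\mathcal H_1,\mathcal H_2$ at $\mu=-\gamma$, $\mu_r=\mu'_r=0$; the coefficients $c_r$ are then taken to be $0$ also when $\sigma(\mu)\sigma(\mu-\gamma)=0$. Let $\varphi$ be the bijection $\varphi(f)(x_1,x_2)=\exp\!\big(\eta_1(x_1^2+x_2^2)/\omega_1\big)\,f\big(\tfrac{x_1}{2\omega_1},\tfrac{x_2}{2\omega_1}\big)$ of the space of functions of two complex variables, and let $\gamma=2\omega_1\hbar$. Then $$\varphi\,\widetilde M_1\,\varphi^{-1}=e^{-2\eta_1\gamma^2/\omega_1}\,\bar{\mathcal H}_1,\qquad \varphi\,\widetilde M_2\,\varphi^{-1}=e^{-2\eta_1\gamma^2/\omega_1}\,\big(\bar{\mathcal H}_2+2\bar{\mathcal H}_1\big).$$ These identities hold for every function $g$ of $(x_1,x_2)$ to which both sides are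 applied, at every point $(x_1,x_2)$ with $x_1\pm x_2\notin\Lambda$ for the first one, and with $z,\,z+\gamma,\,z-\gamma\notin\Lambda$ for both $z=x_1+x_2$ and $z=x_1-x_2$ for the second one. -/

import Mathlib

noncomputable section

namespace EllipticC2

/-! ### Theta and sigma functions -/

/-- The Jacobi theta function `θ₁(z|τ)`, with quasi-periods `1` and `τ`. -/
def theta1 (τ z : ℂ) : ℂ :=
  ∑' k : ℤ, Complex.exp (2 * Real.pi * Complex.I *
    ((z + 1 / 2) * ((k : ℂ) + 1 / 2) + 1 / 2 * ((k : ℂ) + 1 / 2) ^ 2 * τ))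

/-- The Weierstrass sigma function of the period lattice `Λ` of `L`:
`σ(z) = z ∏_{l ∈ Λ, l ≠ 0} (1 - z/l) exp (z/l + z²/(2l²))`.
(The factor with index `l = 0` equals `1`, because `z / 0 = 0` in Lean.) -/
def sigma (L : PeriodPair) (z : ℂ) : ℂ :=
  z * ∏' l : L.lattice, (1 - z / (l : ℂ)) * Complex.exp (z / (l : ℂ) + z ^ 2 / (2 * (l : ℂ) ^ 2))

/-- The Weierstrass zeta function `ζ = σ'/σ`. -/
def zeta (L : PeriodPair) : ℂ → ℂ := logDeriv (sigma L)

/-- The half period `ω₁`. The fields `L.ω₁`, `L.ω₂` of `L` are the full periods, i.e. the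
numbers `2ω₁`, `2ω₂` of the usual notation. -/
def halfω₁ (L : PeriodPair) : ℂ := L.ω₁ / 2

/-- The half period `ω₂`. -/
def halfω₂ (L : PeriodPair) : ℂ := L.ω₂ / 2

/-- `η₁ = ζ(ω₁)`. -/
def eta1 (L : PeriodPair) : ℂ := zeta L (halfω₁ L)

/-- The sigma function shifted by a half period `ω`: `e^{-ζ(ω) z} σ(z + ω) / σ(ω)`. -/
def sigmaShift (L : PeriodPair) (ω z : ℂ) : ℂ :=
  Complex.exp (-zeta L ω * z) * sigma L (z + ω) / sigma L ω

/-- The functions `σ₀ = σ, σ₁, σ₂, σ₃`. The last three are numbered so that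
`σ_r(z) = exp (η₁ z² / (2ω₁)) θ_{r+1}(z/(2ω₁)) / θ_{r+1}(0)`: they belong to the half periods
`ω₁`, `-ω₁-ω₂`, `ω₂` respectively. -/
def sigmaR (L : PeriodPair) : Fin 4 → ℂ → ℂ :=
  ![sigma L, sigmaShift L (halfω₁ L), sigmaShift L (-halfω₁ L - halfω₂ L),
    sigmaShift L (halfω₂ L)]

/-! ### The operators of type `C₂`

A function on `𝔥` is written as a function of the coordinates `λ₁, λ₂`. The weights
`±ε_i` give `λ_{±ε_i} = ±λ_i`, and `T_{±2ε_i}` shifts `λ_i` by `±h`. A sign is an element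
of `ℤˣ = {1, -1}`. -/

/-- The sign `ε`, as a complex number. -/
def sgn (ε : ℤˣ) : ℂ := ((ε : ℤ) : ℂ)

/-- The operator `M̃₁`: the sum over `p = ±ε₁, ±ε₂` of
`∏_{q ≠ ±p} θ₁(λ_{p+q} - h) / θ₁(λ_{p+q}) · T_{2p}`. -/
def M1 (τ h : ℂ) (f : ℂ × ℂ → ℂ) (l : ℂ × ℂ) : ℂ :=
  (∑ ε : ℤˣ, (∏ δ : ℤˣ, theta1 τ (sgn ε * l.1 + sgn δ * l.2 - h) /
      theta1 τ (sgn ε * l.1 + sgn δ * l.2)) * f (l.1 + sgn ε * h, l.2)) +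
  ∑ ε : ℤˣ, (∏ δ : ℤˣ, theta1 τ (sgn ε * l.2 + sgn δ * l.1 - h) /
      theta1 τ (sgn ε * l.2 + sgn δ * l.1)) * f (l.1, l.2 + sgn ε * h)

/-- The operator `M̃₂`: the sum over `p = ±ε₁`, `q = ±ε₂` of
`θ₁(λ_{p+q} - h) / θ₁(λ_{p+q} + h) · T_{2p} T_{2q}
  + θ₁(λ_{p+q} - h) θ₁(λ_{p+q} + 2h) / (θ₁(λ_{p+q}) θ₁(λ_{p+q} + h))`. -/
def M2 (τ h : ℂ) (f : ℂ × ℂ → ℂ) (l : ℂ × ℂ) : ℂ :=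
  ∑ ε : ℤˣ, ∑ δ : ℤˣ,
    (theta1 τ (sgn ε * l.1 + sgn δ * l.2 - h) / theta1 τ (sgn ε * l.1 + sgn δ * l.2 + h) *
        f (l.1 + sgn ε * h, l.2 + sgn δ * h) +
      theta1 τ (sgn ε * l.1 + sgn δ * l.2 - h) * theta1 τ (sgn ε * l.1 + sgn δ * l.2 + 2 * h) /
        (theta1 τ (sgn ε * l.1 + sgn δ * l.2) * theta1 τ (sgn ε * l.1 + sgn δ * l.2 + h)) *
        f l)

/-! ### Van Diejen's operators

`μ`, `m r = μ_r`, `m' r = μ'_r` (`r = 0, 1, 2, 3`) are the coupling parameters and `γ` is the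
step. The functions `v` and `w` below are meromorphic functions on `ℂ`. -/

/-- `v(z) = σ(z + μ) / σ(z)`. -/
def v (L : PeriodPair) (μ z : ℂ) : ℂ := sigma L (z + μ) / sigma L z

/-- `w(z) = ∏_r σ_r(z + μ_r) σ_r(z + μ'_r + γ/2) / (σ_r(z) σ_r(z + γ/2))`, as a meromorphic
function: its value at a removable singularity is the limit there. -/
def w (L : PeriodPair) (γ : ℂ) (m m' : Fin 4 → ℂ) : ℂ → ℂ :=
  toMeromorphicNFOn
    (fun z => ∏ r : Fin 4, sigmaR L r (z + m r) * sigmaR L r (z + m' r + γ / 2) /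
      (sigmaR L r z * sigmaR L r (z + γ / 2))) Set.univ

/-- The permutations `π₀ = id`, `π₁ = (01)(23)`, `π₂ = (02)(13)`, `π₃ = (03)(12)`. -/
def perm : Fin 4 → Equiv.Perm (Fin 4) :=
  ![1, Equiv.swap 0 1 * Equiv.swap 2 3, Equiv.swap 0 2 * Equiv.swap 1 3,
    Equiv.swap 0 3 * Equiv.swap 1 2]

/-- The constants `c_r`. -/
def c (L : PeriodPair) (γ μ : ℂ) (m m' : Fin 4 → ℂ) (r : Fin 4) : ℂ :=
  2 / (sigma L μ * sigma L (μ - γ)) *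
    ∏ s : Fin 4, sigmaR L s (m (perm r s) - γ / 2) * sigmaR L s (m' (perm r s))

/-- `U_{{j},1} = -w(x_j) - w(-x_j)`, as a function of `z = x_j`. -/
def USingle (L : PeriodPair) (γ : ℂ) (m m' : Fin 4 → ℂ) (z : ℂ) : ℂ :=
  -w L γ m m' z - w L γ m m' (-z)

/-- `U_{{1,2},1}`. -/
def UPairOne (L : PeriodPair) (γ μ : ℂ) (m m' : Fin 4 → ℂ) (x : ℂ × ℂ) : ℂ :=
  ∑ r : Fin 4, c L γ μ m m' r *
    ((sigmaR L r (μ - γ / 2 + x.1) * sigmaR L r (μ - γ / 2 - x.1) /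
        (sigmaR L r (-γ / 2 + x.1) * sigmaR L r (-γ / 2 - x.1))) *
      (sigmaR L r (μ - γ / 2 + x.2) * sigmaR L r (μ - γ / 2 - x.2) /
        (sigmaR L r (-γ / 2 + x.2) * sigmaR L r (-γ / 2 - x.2))))

/-- `U_{{1,2},2}`. -/
def UPairTwo (L : PeriodPair) (γ μ : ℂ) (m m' : Fin 4 → ℂ) (x : ℂ × ℂ) : ℂ :=
  ∑ ε : ℤˣ, ∑ δ : ℤˣ, w L γ m m' (sgn ε * x.1) * w L γ m m' (sgn δ * x.2) *
    v L μ (sgn ε * x.1 + sgn δ * x.2) * v L μ (-(sgn ε * x.1) - sgn δ * x.2 - γ)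

/-- The operator `∑_{ε = ±1} w(ε x₁) v(ε x₁ + x₂) v(ε x₁ - x₂) T_{ε1}^γ`. -/
def shiftOne (L : PeriodPair) (γ μ : ℂ) (m m' : Fin 4 → ℂ) (g : ℂ × ℂ → ℂ) (x : ℂ × ℂ) : ℂ :=
  ∑ ε : ℤˣ, w L γ m m' (sgn ε * x.1) * v L μ (sgn ε * x.1 + x.2) * v L μ (sgn ε * x.1 - x.2) *
    g (x.1 + sgn ε * γ, x.2)

/-- The operator `∑_{ε = ±1} w(ε x₂) v(ε x₂ + x₁) v(ε x₂ - x₁) T_{ε2}^γ`. -/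
def shiftTwo (L : PeriodPair) (γ μ : ℂ) (m m' : Fin 4 → ℂ) (g : ℂ × ℂ → ℂ) (x : ℂ × ℂ) : ℂ :=
  ∑ ε : ℤˣ, w L γ m m' (sgn ε * x.2) * v L μ (sgn ε * x.2 + x.1) * v L μ (sgn ε * x.2 - x.1) *
    g (x.1, x.2 + sgn ε * γ)

/-- Van Diejen's first order operator `𝓗₁`. -/
def H1 (L : PeriodPair) (γ μ : ℂ) (m m' : Fin 4 → ℂ) (g : ℂ × ℂ → ℂ) (x : ℂ × ℂ) : ℂ :=
  shiftOne L γ μ m m' g x + shiftTwo L γ μ m m' g x + UPairOne L γ μ m m' x * g x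

/-- Van Diejen's second order operator `𝓗₂`. -/
def H2 (L : PeriodPair) (γ μ : ℂ) (m m' : Fin 4 → ℂ) (g : ℂ × ℂ → ℂ) (x : ℂ × ℂ) : ℂ :=
  (∑ ε : ℤˣ, ∑ δ : ℤˣ, w L γ m m' (sgn ε * x.1) * w L γ m m' (sgn δ * x.2) *
    v L μ (sgn ε * x.1 + sgn δ * x.2) * v L μ (sgn ε * x.1 + sgn δ * x.2 + γ) *
    g (x.1 + sgn ε * γ, x.2 + sgn δ * γ)) +
  USingle L γ m m' x.2 * shiftOne L γ μ m m' g x +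
  USingle L γ m m' x.1 * shiftTwo L γ μ m m' g x +
  UPairTwo L γ μ m m' x * g x

/-- `𝓗̄₁`: the specialization `μ = -γ`, `μ_r = μ'_r = 0` of `𝓗₁`. -/
def H1bar (L : PeriodPair) (γ : ℂ) : (ℂ × ℂ → ℂ) → ℂ × ℂ → ℂ := H1 L γ (-γ) 0 0

/-- `𝓗̄₂`: the specialization `μ = -γ`, `μ_r = μ'_r = 0` of `𝓗₂`. -/
def H2bar (L : PeriodPair) (γ : ℂ) : (ℂ × ℂ → ℂ) → ℂ × ℂ → ℂ := H2 L γ (-γ) 0 0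

/-! ### The gauge map -/

lemma halfω₁_ne_zero (L : PeriodPair) : halfω₁ L ≠ 0 := by
  have h : L.ω₁ ≠ 0 := by simpa using L.indep.ne_zero 0
  exact div_ne_zero h two_ne_zero

/-- The bijection `φ(f)(x₁, x₂) = exp (η₁ (x₁² + x₂²) / ω₁) f(x₁/(2ω₁), x₂/(2ω₁))`
on the functions of two complex variables. -/
def gauge (L : PeriodPair) : (ℂ × ℂ → ℂ) ≃ (ℂ × ℂ → ℂ) where
  toFun f x := Complex.exp (eta1 L * (x.1 ^ 2 + x.2 ^ 2) / halfω₁ L) *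
    f (x.1 / (2 * halfω₁ L), x.2 / (2 * halfω₁ L))
  invFun g l :=
    Complex.exp (-(eta1 L * ((2 * halfω₁ L * l.1) ^ 2 + (2 * halfω₁ L * l.2) ^ 2) / halfω₁ L)) *
      g (2 * halfω₁ L * l.1, 2 * halfω₁ L * l.2)
  left_inv f := by
    have h := halfω₁_ne_zero L
    funext l
    simp [← mul_assoc, ← Complex.exp_add, h]
  right_inv g := by
    have h := halfω₁_ne_zero L
    funext x
    have h1 : 2 * halfω₁ L * (x.1 / (2 * halfω₁ L)) = x.1 := by field_simp
    have h2 : 2 * halfω₁ L * (x.2 / (2 * halfω₁ L)) = x.2 := by field_simp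
    simp only [h1, h2, ← mul_assoc, ← Complex.exp_add]
    simp

end EllipticC2

end

/-!
The theorem rests on `θ₁(z / (2ω₁)) = k · e^{-η₁ z² / (2ω₁)} σ(z)` for some `k ≠ 0`. Both sides are
entire and are multiplied by a nonvanishing factor under translation by each period; for `σ` this
follows by integrating twice the periodicity of `ζ' = -℘`. The right side has simple zeros, exactly
at the lattice points, where `θ₁` vanishes too; hence the quotient is a theta function of some
degree `1 - d`, with `d` the degree of the right side. A theta function of degree `≤ 0`, weighted by
a suitable Gaussian, is continuous and doubly periodic, hence bounded, so it is constant by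
Liouville's theorem. This shows first `d ≥ 1`, since `σ` vanishes at `0` but not identically, and
then that the quotient is constant.

Conjugation by `φ` therefore turns quotients of `θ₁` into quotients of `σ`, and each term acquires
the same factor `e^{-2η₁γ² / ω₁}`. At `μ_r = μ'_r = 0` one has `w = 1`, and `c_r = 0` because the
product defining it contains `σ(0)`.
-/

noncomputable section

namespace EllipticC2

open Complex Filter Topology

/-! ### The Weierstrass sigma function -/

lemma norm_one_sub_mul_exp_sub_one_le {u : ℂ} (hu : ‖u‖ ≤ 1) :
    ‖(1 - u) * exp (u + u ^ 2 / 2) - 1‖ ≤ Real.exp (3 / 2) * ‖u‖ ^ 3 := by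
  have hderiv (t : ℂ) : HasDerivAt (fun t : ℂ ↦ (1 - t) * exp (t + t ^ 2 / 2))
      (-t ^ 2 * exp (t + t ^ 2 / 2)) t := by
    have h1 : HasDerivAt (fun t : ℂ ↦ 1 - t) (-1) t := (hasDerivAt_id t).const_sub 1
    have h2 : HasDerivAt (fun t : ℂ ↦ t + t ^ 2 / 2) (1 + t) t := by
      simpa using (hasDerivAt_id' t).fun_add ((hasDerivAt_pow 2 t).div_const 2)
    exact (h1.mul h2.cexp).congr_deriv (by ring)
  have hbound : ∀ t ∈ Metric.closedBall (0 : ℂ) ‖u‖,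
      ‖-t ^ 2 * exp (t + t ^ 2 / 2)‖ ≤ Real.exp (3 / 2) * ‖u‖ ^ 2 := by
    intro t ht
    rw [mem_closedBall_zero_iff] at ht
    have ht1 : ‖t‖ ≤ 1 := ht.trans hu
    have hexp : ‖t + t ^ 2 / 2‖ ≤ 3 / 2 := by
      calc ‖t + t ^ 2 / 2‖ ≤ ‖t‖ + ‖t ^ 2 / 2‖ := norm_add_le _ _
        _ = ‖t‖ + ‖t‖ ^ 2 / 2 := by simp
        _ ≤ 1 + 1 ^ 2 / 2 := by gcongr
        _ = 3 / 2 := by norm_num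
    rw [norm_mul, norm_neg, norm_pow, mul_comm]
    gcongr
    exact (norm_exp_le_exp_norm _).trans (Real.exp_le_exp.mpr hexp)
  have := (convex_closedBall (0 : ℂ) ‖u‖).norm_image_sub_le_of_norm_hasDerivWithin_le
    (fun t _ ↦ (hderiv t).hasDerivWithinAt) hbound (x := 0) (y := u) (by simp) (by simp)
  simpa [pow_succ _ 2, mul_assoc] using this

/-- The Weierstrass primary factor `(1 - z / l) e^{z / l + z² / (2l²)}` of `σ`, vanishing at the
lattice point `l`. It is the constant `1` for `l = 0`. -/
def sigmaFactor (l z : ℂ) : ℂ := (1 - z / l) * exp (z / l + z ^ 2 / (2 * l ^ 2))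

/-- The entire function `σ(z) / z`, as the product of the primary factors. -/
def sigmaProd (L : PeriodPair) (z : ℂ) : ℂ := ∏' l : L.lattice, sigmaFactor l z

lemma sigma_eq_mul_sigmaProd (L : PeriodPair) : sigma L = fun z ↦ z * sigmaProd L z := rfl

lemma sigmaFactor_zero_left : sigmaFactor 0 = fun _ ↦ 1 := by
  ext z
  simp [sigmaFactor]

@[fun_prop]
lemma differentiable_sigmaFactor (l : ℂ) : Differentiable ℂ (sigmaFactor l) := by
  unfold sigmaFactor
  fun_prop

lemma sigmaFactor_ne_zero {l z : ℂ} (h : z ≠ l) : sigmaFactor l z ≠ 0 := by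
  rcases eq_or_ne l 0 with rfl | hl
  · simp [sigmaFactor_zero_left]
  · refine mul_ne_zero ?_ (exp_ne_zero _)
    rwa [sub_ne_zero, ne_comm, Ne, div_eq_one_iff_eq hl]

lemma norm_sigmaFactor_sub_one_le {l z : ℂ} (h : ‖z‖ ≤ ‖l‖) :
    ‖sigmaFactor l z - 1‖ ≤ Real.exp (3 / 2) * ‖z‖ ^ 3 * (‖l‖ ^ 3)⁻¹ := by
  have hfactor : sigmaFactor l z = (1 - z / l) * exp (z / l + (z / l) ^ 2 / 2) := by
    rw [sigmaFactor, div_pow, div_div, mul_comm 2]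
  have hzl : ‖z / l‖ ≤ 1 := by
    rw [norm_div]
    exact div_le_one_of_le₀ h (norm_nonneg l)
  rw [hfactor]
  refine (norm_one_sub_mul_exp_sub_one_le hzl).trans_eq ?_
  rw [norm_div, div_pow, div_eq_mul_inv (‖z‖ ^ 3), mul_assoc]

variable (L : PeriodPair)

lemma summable_inv_norm_lattice_pow_three : Summable fun l : L.lattice ↦ (‖(l : ℂ)‖ ^ 3)⁻¹ := by
  simpa using ZLattice.summable_norm_pow_inv (L := L.lattice) 3 (by simp)

lemma eventually_norm_sigmaFactor_sub_one_le (R : ℝ) : ∀ᶠ l : L.lattice in cofinite,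
    ∀ z, ‖z‖ ≤ R → ‖sigmaFactor l z - 1‖ ≤ Real.exp (3 / 2) * R ^ 3 * (‖(l : ℂ)‖ ^ 3)⁻¹ := by
  have hfinite : {l : L.lattice | ‖(l : ℂ)‖ ≤ R}.Finite := by
    simpa [Metric.closedBall] using (isCompact_closedBall (0 : L.lattice) R).finite_of_discrete
  filter_upwards [hfinite.compl_mem_cofinite] with l hl z hz
  have hRl : R ≤ ‖(l : ℂ)‖ := (not_le.mp (Set.notMem_ofPred_iff.mp hl)).le
  exact (norm_sigmaFactor_sub_one_le (hz.trans hRl)).trans (by gcongr)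

lemma hasProdLocallyUniformlyOn_sigmaFactor :
    HasProdLocallyUniformlyOn (fun (l : L.lattice) z ↦ sigmaFactor l z) (sigmaProd L) Set.univ := by
  refine hasProdLocallyUniformlyOn_of_forall_compact isOpen_univ fun K _ hK ↦ ?_
  obtain ⟨R, hR⟩ := hK.isBounded.exists_norm_le
  have := ((summable_inv_norm_lattice_pow_three L).mul_left _).hasProdUniformlyOn_one_add hK
    ((eventually_norm_sigmaFactor_sub_one_le L R).mono fun l hl z hz ↦ hl z (hR z hz))
    fun l ↦ ((differentiable_sigmaFactor l).continuous.sub continuous_const).continuousOn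
  simpa only [add_sub_cancel] using! this

lemma tendstoLocallyUniformlyOn_sigmaProd :
    TendstoLocallyUniformlyOn (fun (s : Finset L.lattice) z ↦ ∏ l ∈ s, sigmaFactor l z)
      (sigmaProd L) atTop Set.univ :=
  hasProdLocallyUniformlyOn_iff_tendstoLocallyUniformlyOn.mp
    (hasProdLocallyUniformlyOn_sigmaFactor L)

@[fun_prop]
lemma differentiable_sigmaProd : Differentiable ℂ (sigmaProd L) := by
  rw [← differentiableOn_univ]
  refine (tendstoLocallyUniformlyOn_sigmaProd L).differentiableOn (.of_forall fun s ↦ ?_)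
    isOpen_univ
  fun_prop

@[fun_prop]
lemma differentiable_sigma : Differentiable ℂ (sigma L) :=
  differentiable_id.mul (differentiable_sigmaProd L)

lemma sigma_zero : sigma L 0 = 0 := zero_mul _

lemma sigma_neg (z : ℂ) : sigma L (-z) = -sigma L z := by
  have heven : sigmaProd L (-z) = sigmaProd L z := by
    rw [sigmaProd, ← (Equiv.neg L.lattice).tprod_eq]
    exact tprod_congr fun l ↦ by simp [sigmaFactor]
  simp only [sigma_eq_mul_sigmaProd, heven, neg_mul]

variable {L}

lemma sigmaProd_ne_zero {z : ℂ} (hz : ∀ l ∈ L.lattice, l ≠ 0 → z ≠ l) : sigmaProd L z ≠ 0 := by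
  have hfactor (l : L.lattice) : 1 + (sigmaFactor l z - 1) ≠ 0 := by
    rw [add_sub_cancel]
    rcases eq_or_ne (l : ℂ) 0 with hl | hl
    · simp [hl, sigmaFactor_zero_left]
    · exact sigmaFactor_ne_zero (hz l l.2 hl)
  have hsum : Summable fun l : L.lattice ↦ ‖sigmaFactor l z - 1‖ :=
    ((summable_inv_norm_lattice_pow_three L).mul_left _).of_norm_bounded_eventually <|
      (eventually_norm_sigmaFactor_sub_one_le L ‖z‖).mono fun l hl ↦ by simpa using hl z le_rfl
  simpa only [add_sub_cancel] using! tprod_one_add_ne_zero_of_summable hfactor hsum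

lemma sigmaProd_ne_zero_of_notMem {z : ℂ} (hz : z ∉ L.lattice) : sigmaProd L z ≠ 0 :=
  sigmaProd_ne_zero fun _ hl _ h ↦ hz (h ▸ hl)

lemma ne_zero_of_notMem {z : ℂ} (hz : z ∉ L.lattice) : z ≠ 0 :=
  (ne_of_mem_of_not_mem (zero_mem _) hz).symm

lemma sigma_ne_zero {z : ℂ} (hz : z ∉ L.lattice) : sigma L z ≠ 0 :=
  mul_ne_zero (ne_zero_of_notMem hz) (sigmaProd_ne_zero_of_notMem hz)

variable (L) in
lemma analyticOrderAt_sigma_zero : analyticOrderAt (sigma L) 0 = 1 := by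
  have h0 : sigmaProd L 0 ≠ 0 := sigmaProd_ne_zero fun _ _ hl ↦ hl.symm
  refine ((differentiable_sigma L).analyticAt 0).analyticOrderAt_eq_natCast (n := 1) |>.mpr
    ⟨sigmaProd L, (differentiable_sigmaProd L).analyticAt 0, h0, .of_forall fun z ↦ ?_⟩
  simp [sigma_eq_mul_sigmaProd]

/-! ### Logarithmic derivatives -/

section

variable {f g : ℂ → ℂ} {z : ℂ}

lemma differentiable_deriv (hf : Differentiable ℂ f) : Differentiable ℂ (deriv f) :=
  fun z ↦ (hf.analyticAt z).deriv.differentiableAt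

lemma differentiableAt_logDeriv (hf : Differentiable ℂ f) (hz : f z ≠ 0) :
    DifferentiableAt ℂ (logDeriv f) z :=
  (differentiable_deriv hf z).div (hf z) hz

lemma deriv_logDeriv (hf : Differentiable ℂ f) (hz : f z ≠ 0) :
    deriv (logDeriv f) z = (deriv (deriv f) z * f z - deriv f z * deriv f z) / f z ^ 2 :=
  deriv_fun_div (differentiable_deriv hf z) (hf z) hz

lemma deriv_logDeriv_mul (hf : Differentiable ℂ f) (hg : Differentiable ℂ g)
    (hfz : f z ≠ 0) (hgz : g z ≠ 0) :
    deriv (logDeriv fun z ↦ f z * g z) z = deriv (logDeriv f) z + deriv (logDeriv g) z := by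
  have h : logDeriv (fun z ↦ f z * g z) =ᶠ[𝓝 z] fun y ↦ logDeriv f y + logDeriv g y := by
    filter_upwards [hf.continuous.continuousAt.eventually_ne hfz,
      hg.continuous.continuousAt.eventually_ne hgz] with y hfy hgy
    exact logDeriv_mul y hfy hgy (hf y) (hg y)
  rw [h.deriv_eq, deriv_fun_add (differentiableAt_logDeriv hf hfz)
    (differentiableAt_logDeriv hg hgz)]

lemma deriv_logDeriv_prod {ι : Type*} (s : Finset ι) {f : ι → ℂ → ℂ}
    (hf : ∀ i, Differentiable ℂ (f i)) (hz : ∀ i, f i z ≠ 0) :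
    deriv (logDeriv fun z ↦ ∏ i ∈ s, f i z) z = ∑ i ∈ s, deriv (logDeriv (f i)) z := by
  have h : logDeriv (fun z ↦ ∏ i ∈ s, f i z) =ᶠ[𝓝 z] fun y ↦ ∑ i ∈ s, logDeriv (f i) y := by
    have hne : ∀ᶠ y in 𝓝 z, ∀ i ∈ s, f i y ≠ 0 :=
      (Finset.eventually_all s).mpr fun i _ ↦ (hf i).continuous.continuousAt.eventually_ne (hz i)
    filter_upwards [hne] with y hy
    exact logDeriv_prod hy fun i _ ↦ hf i y
  rw [h.deriv_eq, deriv_fun_sum fun i _ ↦ differentiableAt_logDeriv (hf i) (hz i)]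

lemma tendsto_deriv_logDeriv {ι : Type*} {p : Filter ι} {F : ι → ℂ → ℂ}
    (hF : TendstoLocallyUniformlyOn F f p Set.univ) (hFd : ∀ i, Differentiable ℂ (F i))
    (hf : Differentiable ℂ f) (hz : f z ≠ 0) :
    Tendsto (fun i ↦ deriv (logDeriv (F i)) z) p (𝓝 (deriv (logDeriv f) z)) := by
  have hF' := hF.deriv (.of_forall fun i ↦ (hFd i).differentiableOn) isOpen_univ
  have hF'' := hF'.deriv (.of_forall fun i ↦ (differentiable_deriv (hFd i)).differentiableOn)
    isOpen_univ
  have t0 := hF.tendsto_at (Set.mem_univ z)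
  have t1 := hF'.tendsto_at (Set.mem_univ z)
  have t2 := hF''.tendsto_at (Set.mem_univ z)
  rw [deriv_logDeriv hf hz]
  refine (((t2.mul t0).sub (t1.mul t1)).div (t0.pow 2) (pow_ne_zero 2 hz)).congr' ?_
  filter_upwards [t0.eventually_ne hz] with i hi
  exact (deriv_logDeriv (hFd i) hi).symm

lemma logDeriv_exp_comp {f' : ℂ} (hf : HasDerivAt f f' z) :
    logDeriv (fun z ↦ exp (f z)) z = f' := by
  rw [logDeriv_apply, hf.cexp.deriv, mul_div_cancel_left₀ _ (exp_ne_zero _)]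

end

/-! ### The Weierstrass zeta function -/

lemma logDeriv_sigmaFactor {l z : ℂ} (hl : l ≠ 0) (hz : z ≠ l) :
    logDeriv (sigmaFactor l) z = (z - l)⁻¹ + 1 / l + z / l ^ 2 := by
  have hsub : z - l ≠ 0 := sub_ne_zero.mpr hz
  have hlin : HasDerivAt (fun z : ℂ ↦ 1 - z / l) (-(1 / l)) z :=
    ((hasDerivAt_id z).div_const l).const_sub 1
  have hexp : HasDerivAt (fun z : ℂ ↦ z / l + z ^ 2 / (2 * l ^ 2)) (1 / l + z / l ^ 2) z := by
    refine (((hasDerivAt_id' z).div_const l).fun_add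
      ((hasDerivAt_pow 2 z).div_const (2 * l ^ 2))).congr_deriv ?_
    simp
    field_simp
  have hlin0 : 1 - z / l ≠ 0 := by
    rwa [sub_ne_zero, ne_comm, Ne, div_eq_one_iff_eq hl]
  have hprod := logDeriv_mul (g := fun z ↦ exp (z / l + z ^ 2 / (2 * l ^ 2))) z hlin0
    (exp_ne_zero _) hlin.differentiableAt hexp.cexp.differentiableAt
  rw [logDeriv_exp_comp hexp, logDeriv_apply (fun z ↦ 1 - z / l), hlin.deriv, ← add_assoc] at hprod
  refine hprod.trans ?_
  congr 2
  grind

lemma deriv_logDeriv_sigmaFactor {l z : ℂ} (h : z ≠ l) :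
    deriv (logDeriv (sigmaFactor l)) z = -(if l = 0 then 0 else 1 / (z - l) ^ 2 - 1 / l ^ 2) := by
  split_ifs with hl
  · simp [hl, sigmaFactor_zero_left]
  · have hlog : logDeriv (sigmaFactor l) =ᶠ[𝓝 z] fun y ↦ (y - l)⁻¹ + 1 / l + y / l ^ 2 := by
      filter_upwards [isOpen_ne.mem_nhds h] with y hy
      exact logDeriv_sigmaFactor hl hy
    have hderiv := ((((hasDerivAt_id' z).sub_const l).fun_inv (sub_ne_zero.mpr h)).add_const
      (1 / l)).fun_add ((hasDerivAt_id' z).div_const (l ^ 2))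
    rw [hlog.deriv_eq, hderiv.deriv]
    ring

lemma deriv_logDeriv_sigmaProd {z : ℂ} (hz : z ∉ L.lattice) :
    deriv (logDeriv (sigmaProd L)) z = -L.weierstrassPExcept 0 z := by
  have hlim := tendsto_deriv_logDeriv (tendstoLocallyUniformlyOn_sigmaProd L)
    (fun s ↦ by fun_prop) (differentiable_sigmaProd L) (sigmaProd_ne_zero_of_notMem hz)
  have hsum : Tendsto _ atTop _ := (L.hasSum_weierstrassPExcept 0 z).neg
  refine tendsto_nhds_unique hlim (hsum.congr fun s ↦ ?_)
  have hne (l : L.lattice) : z ≠ l := fun h ↦ hz (h ▸ l.2)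
  rw [deriv_logDeriv_prod s (fun l : L.lattice ↦ differentiable_sigmaFactor l)
    fun l ↦ sigmaFactor_ne_zero (hne l)]
  exact Finset.sum_congr rfl fun l _ ↦ (deriv_logDeriv_sigmaFactor (hne l)).symm

lemma deriv_zeta {z : ℂ} (hz : z ∉ L.lattice) : deriv (zeta L) z = -L.weierstrassP z := by
  have hid : deriv (logDeriv fun z : ℂ ↦ z) z = -(1 / z ^ 2) := by
    simp [funext (logDeriv_id' (𝕜 := ℂ)), neg_div]
  rw [zeta, sigma_eq_mul_sigmaProd, deriv_logDeriv_mul differentiable_fun_id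
    (differentiable_sigmaProd L) (ne_zero_of_notMem hz) (sigmaProd_ne_zero_of_notMem hz), hid,
    deriv_logDeriv_sigmaProd hz, ← L.weierstrassPExcept_add 0 z]
  simp

variable (L) in
lemma zeta_neg (z : ℂ) : zeta L (-z) = -zeta L z := by
  have hderiv : deriv (sigma L) (-z) = deriv (sigma L) z := by
    have := deriv_comp_neg (sigma L) z
    simp only [sigma_neg, deriv.fun_neg] at this
    exact (neg_injective this).symm
  rw [zeta, logDeriv_apply, logDeriv_apply, hderiv, sigma_neg, div_neg]

lemma differentiableAt_zeta {z : ℂ} (hz : z ∉ L.lattice) : DifferentiableAt ℂ (zeta L) z :=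
  differentiableAt_logDeriv (differentiable_sigma L) (sigma_ne_zero hz)

variable (L) in
lemma countable_lattice : (L.lattice : Set ℂ).Countable :=
  Set.countable_coe_iff.mp (inferInstanceAs (Countable L.lattice))

variable (L) in
lemma isPreconnected_compl_lattice : IsPreconnected (L.lattice : Set ℂ)ᶜ :=
  ((countable_lattice L).isConnected_compl_of_one_lt_rank (by simp)).isPreconnected

lemma add_notMem_lattice {l z : ℂ} (hl : l ∈ L.lattice) (hz : z ∉ L.lattice) :
    z + l ∉ L.lattice :=
  fun h ↦ hz ((add_mem_cancel_right hl).mp h)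

section

variable {l : ℂ} (hl : l ∈ L.lattice) (hl2 : l / 2 ∉ L.lattice)
include hl hl2

lemma zeta_add {z : ℂ} (hz : z ∉ L.lattice) :
    zeta L (z + l) = zeta L z + 2 * zeta L (l / 2) := by
  have hd {y : ℂ} (hy : y ∉ L.lattice) : DifferentiableAt ℂ (fun y ↦ zeta L (y + l)) y :=
    (differentiableAt_zeta (add_notMem_lattice hl hy)).comp y (differentiableAt_id.add_const l)
  have hconst : zeta L (z + l) - zeta L z = zeta L (-(l / 2) + l) - zeta L (-(l / 2)) := by
    refine L.isClosed_lattice.isOpen_compl.is_const_of_deriv_eq_zero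
      (f := fun y ↦ zeta L (y + l) - zeta L y) (isPreconnected_compl_lattice L)
      (fun y hy ↦ ((hd hy).sub (differentiableAt_zeta hy)).differentiableWithinAt)
      (fun y hy ↦ ?_) hz (neg_mem_iff.not.mpr hl2)
    rw [deriv_fun_sub (hd hy) (differentiableAt_zeta hy), deriv_comp_add_const, deriv_zeta hy,
      deriv_zeta (add_notMem_lattice hl hy), L.weierstrassP_add_coe y ⟨l, hl⟩]
    simp
  have hhalf : -(l / 2) + l = l / 2 := by ring
  rw [hhalf, zeta_neg] at hconst
  linear_combination hconst

lemma sigma_add (z : ℂ) :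
    sigma L (z + l) = -exp (2 * zeta L (l / 2) * (z + l / 2)) * sigma L z := by
  set E : ℂ → ℂ := fun z ↦ exp (2 * zeta L (l / 2) * (z + l / 2)) with hE
  have hEd : Differentiable ℂ E := by fun_prop
  have hE0 (z : ℂ) : E z ≠ 0 := exp_ne_zero _
  have hlogE (z : ℂ) : logDeriv E z = 2 * zeta L (l / 2) := by
    simpa using logDeriv_exp_comp
      (((hasDerivAt_id' z).add_const (l / 2)).const_mul (2 * zeta L (l / 2)))
  have hshift : Differentiable ℂ fun z ↦ sigma L (z + l) := by fun_prop
  have hlog : Set.EqOn (logDeriv fun z ↦ sigma L (z + l)) (logDeriv fun z ↦ E z * sigma L z)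
      (L.lattice : Set ℂ)ᶜ := by
    intro z hz
    rw [logDeriv_mul z (hE0 z) (sigma_ne_zero hz) (hEd z) (differentiable_sigma L z),
      hlogE, logDeriv_apply, deriv_comp_add_const, add_comm (2 * _)]
    exact zeta_add hl hl2 hz
  obtain ⟨k, -, hk⟩ := (logDeriv_eqOn_iff hshift.differentiableOn
    (hEd.mul (differentiable_sigma L)).differentiableOn L.isClosed_lattice.isOpen_compl
    (isPreconnected_compl_lattice L) (fun z hz ↦ mul_ne_zero (hE0 z) (sigma_ne_zero hz))
    (fun z hz ↦ sigma_ne_zero (add_notMem_lattice hl hz))).mp hlog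
  have hk1 : k = -1 := by
    have hhalf : -(l / 2) + l = l / 2 := by ring
    have : sigma L (-(l / 2) + l) = k * (E (-(l / 2)) * sigma L (-(l / 2))) :=
      hk (neg_mem_iff.not.mpr hl2)
    simp only [hE, hhalf, neg_add_cancel, mul_zero, exp_zero, one_mul, sigma_neg] at this
    exact mul_right_cancel₀ (sigma_ne_zero hl2) (by linear_combination this)
  have hext : (fun z ↦ sigma L (z + l)) = fun z ↦ -E z * sigma L z :=
    hshift.continuous.ext_on ((countable_lattice L).dense_compl ℂ)
      (hEd.neg.mul (differentiable_sigma L)).continuous fun z hz ↦ by simpa [hk1] using hk hz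
  exact congrFun hext z

end

/-! ### Division of entire functions -/

section

variable {f g : ℂ → ℂ}

lemma eventually_ne_zero_nhdsNE (hf : Differentiable ℂ f) (hne : ∃ z, f z ≠ 0) (z : ℂ) :
    ∀ᶠ y in 𝓝[≠] z, f y ≠ 0 := by
  refine (hf.analyticAt z).eventually_eq_zero_or_eventually_ne_zero.resolve_left fun hzero ↦ ?_
  obtain ⟨y, hy⟩ := hne
  exact hy (congrFun ((AnalyticOnNhd.analyticOrderAt_eq_top_iff_eq_zero z hf.analyticAt).mp
    (analyticOrderAt_eq_top.mpr hzero)) y)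

lemma dense_setOf_ne_zero (hf : Differentiable ℂ f) (hne : ∃ z, f z ≠ 0) :
    Dense {z | f z ≠ 0} := by
  intro z
  have := (eventually_ne_zero_nhdsNE hf hne z).frequently
  exact mem_closure_of_frequently_of_tendsto this (tendsto_id.mono_left nhdsWithin_le_nhds)

lemma toMeromorphicNFOn_univ_eventuallyEq {z : ℂ} (hf : MeromorphicOn f Set.univ)
    (hg : AnalyticAt ℂ g z) (hfg : f =ᶠ[𝓝[≠] z] g) :
    toMeromorphicNFOn f Set.univ =ᶠ[𝓝 z] g :=
  (MeromorphicNFAt.eventuallyEq_nhdsNE_iff_eventuallyEq_nhds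
    (meromorphicNFOn_toMeromorphicNFOn f Set.univ (Set.mem_univ z)) hg.meromorphicNFAt).mp
    ((hf.toMeromorphicNFOn_eq_self_on_nhdsNE (Set.mem_univ z)).trans hfg)

lemma exists_analyticAt_eventuallyEq_mul {z : ℂ} (hf : AnalyticAt ℂ f z) (hg : AnalyticAt ℂ g z)
    (hne : analyticOrderAt g z ≠ ⊤) (hle : analyticOrderAt g z ≤ analyticOrderAt f z) :
    ∃ F, AnalyticAt ℂ F z ∧ f =ᶠ[𝓝 z] fun y ↦ F y * g y := by
  obtain ⟨n, hn⟩ := ENat.ne_top_iff_exists.mp hne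
  obtain ⟨g₁, hg₁, hg₁z, hgeq⟩ := (hg.analyticOrderAt_eq_natCast (n := n)).mp hn.symm
  obtain ⟨f₁, hf₁, hfeq⟩ := (natCast_le_analyticOrderAt hf).mp (hn ▸ hle)
  refine ⟨fun y ↦ f₁ y / g₁ y, hf₁.div hg₁ hg₁z, ?_⟩
  filter_upwards [hgeq, hfeq, hg₁.continuousAt.eventually_ne hg₁z] with y hgy hfy hne
  simp only [hgy, hfy, smul_eq_mul]
  field_simp

lemma exists_differentiable_eq_mul (hf : Differentiable ℂ f) (hg : Differentiable ℂ g)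
    (hne : ∃ z, g z ≠ 0) (hle : ∀ z, analyticOrderAt g z ≤ analyticOrderAt f z) :
    ∃ F, Differentiable ℂ F ∧ ∀ z, f z = F z * g z := by
  have hlocal (z : ℂ) : ∃ F, AnalyticAt ℂ F z ∧ f =ᶠ[𝓝 z] fun y ↦ F y * g y := by
    refine exists_analyticAt_eventuallyEq_mul (hf.analyticAt z) (hg.analyticAt z) ?_ (hle z)
    rw [Ne, AnalyticOnNhd.analyticOrderAt_eq_top_iff_eq_zero z hg.analyticAt]
    rintro rfl
    simp at hne
  have hmero : MeromorphicOn (fun z ↦ f z / g z) Set.univ := fun z _ ↦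
    (hf.analyticAt z).meromorphicAt.fun_div (hg.analyticAt z).meromorphicAt
  have hF (z : ℂ) : ∃ F, AnalyticAt ℂ F z ∧ f z = F z * g z ∧
      toMeromorphicNFOn (fun z ↦ f z / g z) Set.univ =ᶠ[𝓝 z] F := by
    obtain ⟨F, hFz, hfF⟩ := hlocal z
    refine ⟨F, hFz, hfF.eq_of_nhds, toMeromorphicNFOn_univ_eventuallyEq hmero hFz ?_⟩
    filter_upwards [hfF.filter_mono nhdsWithin_le_nhds, eventually_ne_zero_nhdsNE hg hne z]
      with y hy hgy
    rw [hy, mul_div_cancel_right₀ _ hgy]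
  refine ⟨toMeromorphicNFOn (fun z ↦ f z / g z) Set.univ, fun z ↦ ?_, fun z ↦ ?_⟩ <;>
    obtain ⟨F, hFz, hfz, hFeq⟩ := hF z
  · exact (hFz.congr hFeq.symm).differentiableAt
  · rw [hfz, hFeq.eq_of_nhds]

lemma analyticOrderAt_add_of_eq_mul {u : ℂ → ℂ} {l : ℂ} (hf : Differentiable ℂ f)
    (hu : Differentiable ℂ u) (hu0 : ∀ z, u z ≠ 0) (h : ∀ z, f (z + l) = u z * f z) (z : ℂ) :
    analyticOrderAt f (z + l) = analyticOrderAt f z := by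
  have hcomp : f ∘ (· + l) = u * f := funext h
  rw [← analyticOrderAt_comp_of_deriv_ne_zero (g := (· + l)) (by fun_prop) (by simp), hcomp,
    analyticOrderAt_mul (hu.analyticAt z) (hf.analyticAt z),
    (hu.analyticAt z).analyticOrderAt_eq_zero.mpr (hu0 z), zero_add]

end

lemma add_eq_div_mul {f g F p q : ℂ → ℂ} {l : ℂ} (hF : Continuous F) (hg : Dense {z | g z ≠ 0})
    (hp : Continuous p) (hq : Continuous q) (hq0 : ∀ z, q z ≠ 0) (hmul : ∀ z, f z = F z * g z)
    (hfl : ∀ z, f (z + l) = p z * f z) (hgl : ∀ z, g (z + l) = q z * g z) (z : ℂ) :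
    F (z + l) = p z / q z * F z := by
  have hFl : Continuous fun z ↦ F (z + l) := hF.comp (continuous_add_const l)
  have hpq : Continuous fun z ↦ p z / q z * F z := (hp.div hq hq0).mul hF
  refine congrFun (hFl.ext_on hg hpq fun z (hz : g z ≠ 0) ↦ ?_) z
  have : F (z + l) * (q z * g z) = p z * (F z * g z) := by
    rw [← hgl, ← hmul, ← hmul, hfl]
  have hz0 := hq0 z
  field_simp
  exact mul_right_cancel₀ hz (by linear_combination this)

/-! ### Theta functions of a period lattice -/

variable (L) in
lemma ω₁_ne_zero : L.ω₁ ≠ 0 := by simpa using L.indep.ne_zero 0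

/-- The ratio of the periods. -/
def ratio (L : PeriodPair) : ℂ := L.ω₂ / L.ω₁

variable (L) in
lemma add_ω₁_div (z : ℂ) : (z + L.ω₁) / L.ω₁ = z / L.ω₁ + 1 := by
  rw [add_div, div_self (ω₁_ne_zero L)]

variable (L) in
lemma add_ω₂_div (z : ℂ) : (z + L.ω₂) / L.ω₁ = z / L.ω₁ + ratio L := by
  rw [add_div, ratio]

lemma eq_of_mem_lattice {α : Type*} {f : ℂ → α} (h₁ : Function.Periodic f L.ω₁)
    (h₂ : Function.Periodic f L.ω₂) (z : ℂ) {l : ℂ} (hl : l ∈ L.lattice) : f (z + l) = f z := by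
  obtain ⟨m, n, rfl⟩ := PeriodPair.mem_lattice.mp hl
  exact ((h₁.int_mul m).add_period (h₂.int_mul n)) z

/-- The exponential factor that a theta function of degree `1` acquires under translation
by `ω₂`. -/
def thetaFactor (L : PeriodPair) (z : ℂ) : ℂ := exp (-(2 * Real.pi * I * (z + L.ω₂ / 2) / L.ω₁))

/-- A theta function of degree `d` for the lattice of `L`: an entire function multiplied by a
unimodular constant under translation by `ω₁`, and by such a constant times the `d`-th power of
`thetaFactor L` under translation by `ω₂`. Unless it vanishes identically, `d` is the number of its
zeros modulo the lattice when `Im (ω₂ / ω₁) > 0`. -/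
structure IsThetaFunction (L : PeriodPair) (d : ℤ) (f : ℂ → ℂ) : Prop where
  differentiable : Differentiable ℂ f
  add_ω₁ : ∃ u : ℂ, ‖u‖ = 1 ∧ ∀ z, f (z + L.ω₁) = u * f z
  add_ω₂ : ∃ u : ℂ, ‖u‖ = 1 ∧ ∀ z, f (z + L.ω₂) = u * thetaFactor L z ^ d * f z

lemma thetaFactor_ne_zero (z : ℂ) : thetaFactor L z ≠ 0 := exp_ne_zero _

lemma differentiable_thetaFactor_zpow (d : ℤ) : Differentiable ℂ fun z ↦ thetaFactor L z ^ d := by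
  simp only [thetaFactor, ← exp_int_mul]
  fun_prop

lemma norm_thetaFactor_zpow (d : ℤ) (z : ℂ) :
    ‖thetaFactor L z ^ d‖ = Real.exp (Real.pi * d * (2 * (z / L.ω₁).im + (ratio L).im)) := by
  have : d * -(2 * Real.pi * I * (z + L.ω₂ / 2) / L.ω₁) =
      ((Real.pi * d : ℝ) : ℂ) * (-(2 * (z / L.ω₁) + ratio L) * I) := by
    rw [ratio]
    push_cast
    ring
  rw [thetaFactor, ← exp_int_mul, norm_exp, this, re_ofReal_mul, mul_I_re, neg_im, neg_neg, add_im]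
  simp

namespace IsThetaFunction

variable {d e : ℤ} {f g : ℂ → ℂ}

lemma analyticOrderAt_add (hf : IsThetaFunction L d f) (z : ℂ) {l : ℂ} (hl : l ∈ L.lattice) :
    analyticOrderAt f (z + l) = analyticOrderAt f z := by
  obtain ⟨u₁, hu₁, h₁⟩ := hf.add_ω₁
  obtain ⟨u₂, hu₂, h₂⟩ := hf.add_ω₂
  have hne {u : ℂ} (hu : ‖u‖ = 1) : u ≠ 0 := norm_ne_zero_iff.mp (hu ▸ one_ne_zero)
  exact eq_of_mem_lattice (f := analyticOrderAt f)
    (analyticOrderAt_add_of_eq_mul hf.differentiable (differentiable_const u₁)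
      (fun _ ↦ hne hu₁) h₁)
    (analyticOrderAt_add_of_eq_mul hf.differentiable
      ((differentiable_thetaFactor_zpow d).const_mul u₂)
      (fun z ↦ mul_ne_zero (hne hu₂) (zpow_ne_zero d (thetaFactor_ne_zero z))) h₂) z hl

lemma of_eq_mul (hf : IsThetaFunction L d f) (hg : IsThetaFunction L e g) (hne : ∃ z, g z ≠ 0)
    {F : ℂ → ℂ} (hF : Differentiable ℂ F) (hmul : ∀ z, f z = F z * g z) :
    IsThetaFunction L (d - e) F := by
  obtain ⟨u₁, hu₁, hf₁⟩ := hf.add_ω₁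
  obtain ⟨u₂, hu₂, hf₂⟩ := hf.add_ω₂
  obtain ⟨v₁, hv₁, hg₁⟩ := hg.add_ω₁
  obtain ⟨v₂, hv₂, hg₂⟩ := hg.add_ω₂
  have hv₁0 : v₁ ≠ 0 := norm_ne_zero_iff.mp (hv₁ ▸ one_ne_zero)
  have hv₂0 : v₂ ≠ 0 := norm_ne_zero_iff.mp (hv₂ ▸ one_ne_zero)
  have hcont (d : ℤ) : Continuous fun z ↦ thetaFactor L z ^ d :=
    (differentiable_thetaFactor_zpow d).continuous
  have hdense := dense_setOf_ne_zero hg.differentiable hne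
  refine ⟨hF, ⟨u₁ / v₁, by rw [norm_div, hu₁, hv₁, div_one], ?_⟩,
    ⟨u₂ / v₂, by rw [norm_div, hu₂, hv₂, div_one], fun z ↦ ?_⟩⟩
  · exact add_eq_div_mul hF.continuous hdense continuous_const continuous_const (fun _ ↦ hv₁0) hmul
      hf₁ hg₁
  · rw [zpow_sub₀ (thetaFactor_ne_zero z), div_mul_div_comm]
    exact add_eq_div_mul hF.continuous hdense (continuous_const.mul (hcont d))
      (continuous_const.mul (hcont e))
      (fun z ↦ mul_ne_zero hv₂0 (zpow_ne_zero e (thetaFactor_ne_zero z))) hmul hf₂ hg₂ z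

section

variable (hL : 0 < (ratio L).im)
include hL

lemma isBounded_range (hf : IsThetaFunction L d f) :
    Bornology.IsBounded (Set.range fun z ↦
      ‖f z‖ * Real.exp (-(Real.pi * d * (z / L.ω₁).im ^ 2 / (ratio L).im))) := by
  obtain ⟨u₁, hu₁, h₁⟩ := hf.add_ω₁
  obtain ⟨u₂, hu₂, h₂⟩ := hf.add_ω₂
  have hcont : Continuous fun z ↦
      ‖f z‖ * Real.exp (-(Real.pi * d * (z / L.ω₁).im ^ 2 / (ratio L).im)) := by
    have := hf.differentiable.continuous
    fun_prop
  refine (IsZLattice.isCompact_range_of_periodic L.lattice _ hcont fun z l hl ↦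
    eq_of_mem_lattice (f := fun z ↦ ‖f z‖ * Real.exp (-(Real.pi * d * (z / L.ω₁).im ^ 2 /
      (ratio L).im))) (fun z ↦ ?_) (fun z ↦ ?_) z hl).isBounded
  · simp [h₁, hu₁, add_ω₁_div]
  · simp only [h₂, norm_mul, hu₂, one_mul, norm_thetaFactor_zpow, add_ω₂_div, add_im]
    rw [mul_comm (Real.exp _), mul_assoc, ← Real.exp_add]
    congr 2
    field_simp
    ring

lemma apply_eq_apply (hf : IsThetaFunction L d f) (hd : d ≤ 0) (z w : ℂ) : f z = f w := by
  obtain ⟨C, hC⟩ := (hf.isBounded_range hL).exists_norm_le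
  refine hf.differentiable.apply_eq_apply_of_bounded
    (isBounded_iff_forall_norm_le.mpr ⟨C, ?_⟩) z w
  rintro _ ⟨z, rfl⟩
  have hexp : 1 ≤ Real.exp (-(Real.pi * d * (z / L.ω₁).im ^ 2 / (ratio L).im)) := by
    rw [Real.one_le_exp_iff, neg_nonneg]
    have : (d : ℝ) ≤ 0 := by exact_mod_cast hd
    exact div_nonpos_of_nonpos_of_nonneg (mul_nonpos_of_nonpos_of_nonneg
      (mul_nonpos_of_nonneg_of_nonpos Real.pi_nonneg this) (sq_nonneg _)) hL.le
  calc ‖f z‖ ≤ ‖f z‖ * Real.exp (-(Real.pi * d * (z / L.ω₁).im ^ 2 / (ratio L).im)) :=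
        le_mul_of_one_le_right (norm_nonneg _) hexp
    _ ≤ C := (le_abs_self _).trans (hC _ ⟨z, rfl⟩)

lemma exists_eq_const_mul (hf : IsThetaFunction L d f) (hg : IsThetaFunction L e g)
    (hde : d ≤ e) (hne : ∃ z, g z ≠ 0) (hle : ∀ z, analyticOrderAt g z ≤ analyticOrderAt f z) :
    ∃ k, ∀ z, f z = k * g z := by
  obtain ⟨F, hF, hmul⟩ := exists_differentiable_eq_mul hf.differentiable hg.differentiable hne hle
  have hconst := (hf.of_eq_mul hg hne hF hmul).apply_eq_apply hL (sub_nonpos.mpr hde)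
  exact ⟨F 0, fun z ↦ by rw [hmul, hconst z 0]⟩

end

end IsThetaFunction

/-! ### The theta function `θ₁` -/

lemma theta1_eq (τ z : ℂ) : theta1 τ z =
    exp (Real.pi * I * (z + 1 / 2 + τ / 4)) * jacobiTheta₂ (z + (1 + τ) / 2) τ := by
  rw [theta1, jacobiTheta₂, ← tsum_mul_left]
  refine tsum_congr fun k ↦ ?_
  rw [jacobiTheta₂_term, ← exp_add]
  ring_nf

lemma theta1_add_one (τ z : ℂ) : theta1 τ (z + 1) = -theta1 τ z := by
  have hshift : z + 1 + (1 + τ) / 2 = z + (1 + τ) / 2 + 1 := by ring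
  have hexp : (Real.pi * I * (z + 1 + 1 / 2 + τ / 4) : ℂ) =
    Real.pi * I * (z + 1 / 2 + τ / 4) + Real.pi * I := by ring
  rw [theta1_eq, theta1_eq, hshift, jacobiTheta₂_add_left, hexp, exp_add, exp_pi_mul_I]
  ring

lemma theta1_add_tau (τ z : ℂ) :
    theta1 τ (z + τ) = -exp (-(Real.pi * I * (2 * z + τ))) * theta1 τ z := by
  have hshift : z + τ + (1 + τ) / 2 = z + (1 + τ) / 2 + τ := by ring
  have hneg : exp (-(Real.pi * I)) = -1 := by rw [exp_neg, exp_pi_mul_I, inv_neg_one]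
  rw [theta1_eq, theta1_eq, hshift, jacobiTheta₂_add_left', ← mul_assoc, ← mul_assoc, ← exp_add,
    ← neg_one_mul (exp (-(Real.pi * I * (2 * z + τ)))), ← hneg, ← exp_add, ← exp_add]
  ring_nf

lemma theta1_neg (τ z : ℂ) : theta1 τ (-z) = -theta1 τ z := by
  have hshift : -z + (1 + τ) / 2 = -(z - (1 + τ) / 2) := by ring
  have hshift' : z + (1 + τ) / 2 = z - (1 + τ) / 2 + 1 + τ := by ring
  have hneg : exp (Real.pi * I) = -1 := exp_pi_mul_I
  rw [theta1_eq, theta1_eq, hshift, jacobiTheta₂_neg_left, hshift', jacobiTheta₂_add_left',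
    jacobiTheta₂_add_left, ← mul_assoc, ← neg_one_mul (exp _ * exp _ * _), ← hneg, ← mul_assoc,
    ← exp_add, ← exp_add]
  ring_nf

lemma theta1_zero (τ : ℂ) : theta1 τ 0 = 0 := by
  simpa [self_eq_neg] using theta1_neg τ 0

section

variable {τ : ℂ} (hτ : 0 < τ.im)
include hτ

lemma differentiable_theta1 : Differentiable ℂ (theta1 τ) := by
  have hj : Differentiable ℂ fun z ↦ jacobiTheta₂ z τ :=
    fun z ↦ differentiableAt_jacobiTheta₂_fst z hτ
  have hj' : Differentiable ℂ fun z ↦ jacobiTheta₂ (z + (1 + τ) / 2) τ :=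
    hj.comp (differentiable_id.add_const ((1 + τ) / 2))
  rw [funext (theta1_eq τ)]
  fun_prop

lemma integral_jacobiTheta₂ : ∫ x in (0 : ℝ)..1, jacobiTheta₂ x τ = 1 := by
  have hcont (n : ℤ) : Continuous fun x : ℝ ↦ jacobiTheta₂_term n x τ := by
    unfold jacobiTheta₂_term
    fun_prop
  have hsum : Summable fun n : ℤ ↦
      ‖(⟨fun x : ℝ ↦ jacobiTheta₂_term n x τ, hcont n⟩ : C(ℝ, ℂ)).restrict
        (⟨Set.uIcc (0 : ℝ) 1, isCompact_uIcc⟩ : TopologicalSpace.Compacts ℝ)‖ := by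
    refine Summable.of_nonneg_of_le (fun n ↦ norm_nonneg _) (fun n ↦ ?_)
      ((summable_jacobiTheta₂_term_iff 0 τ).mpr hτ).norm
    exact (ContinuousMap.norm_le _ (norm_nonneg _)).mpr fun x ↦ by simp [norm_jacobiTheta₂_term]
  have hterm (n : ℤ) : ∫ x in (0 : ℝ)..1, jacobiTheta₂_term n x τ = if n = 0 then 1 else 0 := by
    split_ifs with hn
    · simp [hn, jacobiTheta₂_term]
    · have hn0 : (2 * Real.pi * I * n : ℂ) ≠ 0 :=
        mul_ne_zero two_pi_I_ne_zero (Int.cast_ne_zero.mpr hn)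
      have hexp : exp (2 * Real.pi * I * n) = 1 := by
        rw [mul_comm]
        exact exp_int_mul_two_pi_mul_I n
      simp only [jacobiTheta₂_term, exp_add]
      rw [intervalIntegral.integral_mul_const, integral_exp_mul_complex hn0]
      simp [hexp]
  have hhas := intervalIntegral.hasSum_intervalIntegral_of_summable_norm hsum
  simp only [ContinuousMap.coe_mk, hterm] at hhas
  exact hhas.unique (hasSum_ite_eq 0 1)

-- The Fourier series `jacobiTheta₂` has constant coefficient `1`.
lemma exists_theta1_ne_zero : ∃ z, theta1 τ z ≠ 0 := by
  by_contra! h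
  have hzero (z : ℂ) : jacobiTheta₂ z τ = 0 := by
    have := h (z - (1 + τ) / 2)
    rw [theta1_eq, sub_add_cancel] at this
    exact (mul_eq_zero.mp this).resolve_left (exp_ne_zero _)
  simpa [hzero] using integral_jacobiTheta₂ hτ

end

/-- The function `θ₁`, rescaled to the periods of `L`. -/
def latticeTheta (L : PeriodPair) (z : ℂ) : ℂ := theta1 (ratio L) (z / L.ω₁)

variable (L) in
lemma latticeTheta_zero : latticeTheta L 0 = 0 := by
  rw [latticeTheta, zero_div, theta1_zero]

section

variable (hL : 0 < (ratio L).im)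
include hL

lemma exists_latticeTheta_ne_zero : ∃ z, latticeTheta L z ≠ 0 := by
  obtain ⟨z, hz⟩ := exists_theta1_ne_zero hL
  refine ⟨z * L.ω₁, ?_⟩
  rwa [latticeTheta, mul_div_cancel_right₀ _ (ω₁_ne_zero L)]

lemma isThetaFunction_latticeTheta : IsThetaFunction L 1 (latticeTheta L) where
  differentiable := (differentiable_theta1 hL).comp (differentiable_id.div_const L.ω₁)
  add_ω₁ := by
    refine ⟨-1, by simp, fun z ↦ ?_⟩
    rw [latticeTheta, add_ω₁_div, theta1_add_one, neg_one_mul, latticeTheta]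
  add_ω₂ := by
    refine ⟨-1, by simp, fun z ↦ ?_⟩
    have hexp : Real.pi * I * (2 * (z / L.ω₁) + ratio L) =
        2 * Real.pi * I * (z + L.ω₂ / 2) / L.ω₁ := by
      rw [ratio]
      ring
    rw [latticeTheta, add_ω₂_div, theta1_add_tau, hexp, zpow_one, neg_one_mul]
    rfl

end

/-! ### Comparison of `σ` and `θ₁` -/

/-- The function `e^{-η₁ z² / (2ω₁)} σ(z)`: the Gaussian factor makes it antiperiodic under
translation by the first period. -/
def gaussianSigma (L : PeriodPair) (z : ℂ) : ℂ :=
  exp (-(eta1 L / halfω₁ L * z ^ 2 / 2)) * sigma L z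

/-- The constant `2η₂ - η₁ ω₂ / ω₁`, in terms of the half periods `ω₁` and `ω₂`. -/
def quasiPeriod (L : PeriodPair) : ℂ := 2 * zeta L (L.ω₂ / 2) - eta1 L / halfω₁ L * L.ω₂

variable (L)

lemma gaussianSigma_add_ω₁ (z : ℂ) : gaussianSigma L (z + L.ω₁) = -gaussianSigma L z := by
  have hexp : exp (-(eta1 L / halfω₁ L * (z + L.ω₁) ^ 2 / 2)) *
      exp (2 * zeta L (L.ω₁ / 2) * (z + L.ω₁ / 2)) =
      exp (-(eta1 L / halfω₁ L * z ^ 2 / 2)) := by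
    have := ω₁_ne_zero L
    rw [← exp_add, eta1, halfω₁]
    congr 1
    field_simp
    ring
  rw [gaussianSigma, sigma_add L.ω₁_mem_lattice L.ω₁_div_two_notMem_lattice, gaussianSigma, ← hexp]
  ring

lemma gaussianSigma_add_ω₂ (z : ℂ) : gaussianSigma L (z + L.ω₂) =
    -exp (quasiPeriod L * (z + L.ω₂ / 2)) * gaussianSigma L z := by
  have hexp : exp (-(eta1 L / halfω₁ L * (z + L.ω₂) ^ 2 / 2)) *
      exp (2 * zeta L (L.ω₂ / 2) * (z + L.ω₂ / 2)) =
      exp (quasiPeriod L * (z + L.ω₂ / 2)) * exp (-(eta1 L / halfω₁ L * z ^ 2 / 2)) := by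
    rw [← exp_add, ← exp_add, quasiPeriod]
    ring_nf
  rw [gaussianSigma, sigma_add L.ω₂_mem_lattice L.ω₂_div_two_notMem_lattice, gaussianSigma]
  linear_combination -sigma L z * hexp

variable {L} in
lemma gaussianSigma_ne_zero {z : ℂ} (hz : z ∉ L.lattice) : gaussianSigma L z ≠ 0 :=
  mul_ne_zero (exp_ne_zero _) (sigma_ne_zero hz)

lemma differentiable_gaussianSigma : Differentiable ℂ (gaussianSigma L) := by
  unfold gaussianSigma
  fun_prop

lemma analyticOrderAt_gaussianSigma_zero : analyticOrderAt (gaussianSigma L) 0 = 1 := by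
  have hexp : Differentiable ℂ fun z ↦ exp (-(eta1 L / halfω₁ L * z ^ 2 / 2)) := by fun_prop
  have hmul : gaussianSigma L = (fun z ↦ exp (-(eta1 L / halfω₁ L * z ^ 2 / 2))) * sigma L := rfl
  rw [hmul, analyticOrderAt_mul (hexp.analyticAt 0) ((differentiable_sigma L).analyticAt 0),
    analyticOrderAt_sigma_zero, (hexp.analyticAt 0).analyticOrderAt_eq_zero.mpr (exp_ne_zero _),
    zero_add]

-- The translations by the two periods commute, which forces `exp (quasiPeriod L * ω₁) = 1`.
lemma exists_quasiPeriod_eq : ∃ n : ℤ, quasiPeriod L * L.ω₁ = n * (2 * Real.pi * I) := by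
  set z := L.ω₁ / 2
  have hcomm : gaussianSigma L (z + L.ω₁ + L.ω₂) = gaussianSigma L (z + L.ω₂ + L.ω₁) := by
    rw [add_right_comm]
  have hsplit : exp (quasiPeriod L * (z + L.ω₁ + L.ω₂ / 2)) =
      exp (quasiPeriod L * L.ω₁) * exp (quasiPeriod L * (z + L.ω₂ / 2)) := by
    rw [← exp_add]
    ring_nf
  simp only [gaussianSigma_add_ω₁, gaussianSigma_add_ω₂, hsplit] at hcomm
  refine exp_eq_one_iff.mp (mul_right_cancel₀
    (mul_ne_zero (exp_ne_zero (quasiPeriod L * (z + L.ω₂ / 2)))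
      (gaussianSigma_ne_zero L.ω₁_div_two_notMem_lattice)) ?_)
  linear_combination hcomm

lemma exists_isThetaFunction_gaussianSigma : ∃ d, IsThetaFunction L d (gaussianSigma L) := by
  obtain ⟨n, hn⟩ := exists_quasiPeriod_eq L
  refine ⟨-n, differentiable_gaussianSigma L, ⟨-1, by simp, by simp [gaussianSigma_add_ω₁]⟩,
    -1, by simp, fun z ↦ ?_⟩
  have hexp : quasiPeriod L * (z + L.ω₂ / 2) =
      (-n : ℤ) * -(2 * Real.pi * I * (z + L.ω₂ / 2) / L.ω₁) := by
    rw [eq_div_of_mul_eq (ω₁_ne_zero L) hn]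
    push_cast
    ring
  rw [gaussianSigma_add_ω₂, thetaFactor, ← exp_int_mul, hexp, neg_one_mul]

variable {L} in
lemma analyticOrderAt_gaussianSigma_le (hL : 0 < (ratio L).im) {d : ℤ}
    (hσ : IsThetaFunction L d (gaussianSigma L)) (z : ℂ) :
    analyticOrderAt (gaussianSigma L) z ≤ analyticOrderAt (latticeTheta L) z := by
  have hθ := isThetaFunction_latticeTheta hL
  by_cases hz : z ∈ L.lattice
  · rw [← zero_add z, hσ.analyticOrderAt_add 0 hz, hθ.analyticOrderAt_add 0 hz,
      analyticOrderAt_gaussianSigma_zero, Order.one_le_iff_ne_zero,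
      (hθ.differentiable.analyticAt 0).analyticOrderAt_ne_zero]
    exact latticeTheta_zero L
  · rw [(hσ.differentiable.analyticAt z).analyticOrderAt_eq_zero.mpr (gaussianSigma_ne_zero hz)]
    exact zero_le

variable {L} in
lemma exists_theta1_eq_mul_sigma (hL : 0 < (ratio L).im) : ∃ k ≠ 0, ∀ z,
    theta1 (ratio L) (z / L.ω₁) = k * (exp (-(eta1 L / halfω₁ L * z ^ 2 / 2)) * sigma L z) := by
  obtain ⟨d, hσ⟩ := exists_isThetaFunction_gaussianSigma L
  have hhalf := gaussianSigma_ne_zero L.ω₁_div_two_notMem_lattice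
  have hd : 0 < d := by
    by_contra! hd
    refine hhalf ((hσ.apply_eq_apply hL hd _ 0).trans ?_)
    rw [gaussianSigma, sigma_zero, mul_zero]
  obtain ⟨k, hk⟩ := (isThetaFunction_latticeTheta hL).exists_eq_const_mul hL hσ hd ⟨_, hhalf⟩
    (analyticOrderAt_gaussianSigma_le hL hσ)
  refine ⟨k, ?_, hk⟩
  rintro rfl
  obtain ⟨z, hz⟩ := exists_latticeTheta_ne_zero hL
  exact hz (by rw [hk, zero_mul])

/-! ### The specialization `μ_r = μ'_r = 0` -/

lemma neg_halfω₁_sub_halfω₂_notMem_lattice : -halfω₁ L - halfω₂ L ∉ L.lattice := by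
  have h := (L.mul_ω₁_add_mul_ω₂_mem_lattice (α := -1 / 2) (β := -1 / 2)).not.mpr (by norm_num)
  convert h using 2
  rw [halfω₁, halfω₂]
  push_cast
  ring

lemma differentiable_sigmaShift (ω : ℂ) : Differentiable ℂ (sigmaShift L ω) := by
  unfold sigmaShift
  fun_prop

variable {L} in
lemma sigmaShift_zero {ω : ℂ} (hω : ω ∉ L.lattice) : sigmaShift L ω 0 = 1 := by
  simp [sigmaShift, sigma_ne_zero hω]

lemma differentiable_sigmaR (r : Fin 4) : Differentiable ℂ (sigmaR L r) := by
  fin_cases r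
  · exact differentiable_sigma L
  all_goals exact differentiable_sigmaShift L _

lemma exists_sigmaR_ne_zero (r : Fin 4) : ∃ z, sigmaR L r z ≠ 0 := by
  have h {ω : ℂ} (hω : ω ∉ L.lattice) : ∃ z, sigmaShift L ω z ≠ 0 :=
    ⟨0, by simp [sigmaShift_zero hω]⟩
  fin_cases r
  · exact ⟨_, sigma_ne_zero L.ω₁_div_two_notMem_lattice⟩
  · exact h L.ω₁_div_two_notMem_lattice
  · exact h (neg_halfω₁_sub_halfω₂_notMem_lattice L)
  · exact h L.ω₂_div_two_notMem_lattice

lemma w_zero_zero (γ z : ℂ) : w L γ 0 0 z = 1 := by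
  set f : ℂ → ℂ := fun z ↦ ∏ r : Fin 4,
    sigmaR L r (z + (0 : Fin 4 → ℂ) r) * sigmaR L r (z + (0 : Fin 4 → ℂ) r + γ / 2) /
      (sigmaR L r z * sigmaR L r (z + γ / 2)) with hf
  have hev (x : ℂ) : f =ᶠ[𝓝[≠] x] fun _ ↦ 1 := by
    have h1 : ∀ᶠ y in 𝓝[≠] x, ∀ r, sigmaR L r y ≠ 0 := eventually_all.mpr fun r ↦
      eventually_ne_zero_nhdsNE (differentiable_sigmaR L r) (exists_sigmaR_ne_zero L r) x
    have h2 : ∀ᶠ y in 𝓝[≠] x, ∀ r, sigmaR L r (y + γ / 2) ≠ 0 := by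
      refine eventually_all.mpr fun r ↦ ?_
      obtain ⟨u, hu⟩ := exists_sigmaR_ne_zero L r
      exact eventually_ne_zero_nhdsNE (f := fun y ↦ sigmaR L r (y + γ / 2))
        ((differentiable_sigmaR L r).comp (differentiable_id.add_const _))
        ⟨u - γ / 2, by simpa using hu⟩ x
    filter_upwards [h1, h2] with y hy1 hy2
    simp only [hf, Pi.zero_apply, add_zero]
    exact Finset.prod_eq_one fun r _ ↦ div_self (mul_ne_zero (hy1 r) (hy2 r))
  have hmero : MeromorphicOn f Set.univ := fun x _ ↦
    (MeromorphicAt.meromorphicAt_congr (hev x)).mpr (MeromorphicAt.const 1 x)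
  exact (toMeromorphicNFOn_univ_eventuallyEq hmero analyticAt_const (hev z)).eq_of_nhds

lemma c_zero_zero (γ μ : ℂ) (r : Fin 4) : c L γ μ 0 0 r = 0 := by
  have h : sigmaR L 0 0 = 0 := sigma_zero L
  rw [c, Finset.prod_eq_zero (Finset.mem_univ 0) (by simp [h]), mul_zero]

lemma UPairOne_zero_zero (γ μ : ℂ) (x : ℂ × ℂ) : UPairOne L γ μ 0 0 x = 0 := by
  simp [UPairOne, c_zero_zero]

lemma H1bar_eq (γ : ℂ) (g : ℂ × ℂ → ℂ) (x : ℂ × ℂ) :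
    H1bar L γ g x =
      (∑ ε : ℤˣ, v L (-γ) (sgn ε * x.1 + x.2) * v L (-γ) (sgn ε * x.1 - x.2) *
        g (x.1 + sgn ε * γ, x.2)) +
      ∑ ε : ℤˣ, v L (-γ) (sgn ε * x.2 + x.1) * v L (-γ) (sgn ε * x.2 - x.1) *
        g (x.1, x.2 + sgn ε * γ) := by
  simp only [H1bar, H1, shiftOne, shiftTwo, UPairOne_zero_zero, w_zero_zero, one_mul, zero_mul,
    add_zero]

-- With `w = 1`, the two `USingle` terms of `𝓗̄₂` add up to `-2 𝓗̄₁`.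
lemma H2bar_add_two_mul_H1bar (γ : ℂ) (g : ℂ × ℂ → ℂ) (x : ℂ × ℂ) :
    H2bar L γ g x + 2 * H1bar L γ g x =
      ∑ ε : ℤˣ, ∑ δ : ℤˣ,
        (v L (-γ) (sgn ε * x.1 + sgn δ * x.2) * v L (-γ) (sgn ε * x.1 + sgn δ * x.2 + γ) *
          g (x.1 + sgn ε * γ, x.2 + sgn δ * γ) +
        v L (-γ) (sgn ε * x.1 + sgn δ * x.2) * v L (-γ) (-(sgn ε * x.1 + sgn δ * x.2) - γ) *
          g x) := by
  simp only [H1bar, H2bar, H1, H2, USingle, UPairOne_zero_zero, UPairTwo, w_zero_zero, one_mul,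
    zero_mul, add_zero, Finset.sum_add_distrib, Finset.sum_mul, neg_add']
  ring

/-! ### The gauge transformation -/

lemma two_mul_halfω₁ : 2 * halfω₁ L = L.ω₁ := by
  rw [halfω₁, mul_div_cancel₀ _ two_ne_zero]

lemma halfω₂_div_halfω₁ : halfω₂ L / halfω₁ L = ratio L :=
  div_div_div_cancel_right₀ two_ne_zero L.ω₂ L.ω₁

lemma gauge_apply (f : ℂ × ℂ → ℂ) (x : ℂ × ℂ) :
    gauge L f x = exp (eta1 L / halfω₁ L * (x.1 ^ 2 + x.2 ^ 2)) * f (x.1 / L.ω₁, x.2 / L.ω₁) := by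
  rw [← two_mul_halfω₁, div_mul_eq_mul_div]
  rfl

lemma gauge_symm_apply (g : ℂ × ℂ → ℂ) (a b : ℂ) :
    (gauge L).symm g (a / L.ω₁, b / L.ω₁) =
      exp (-(eta1 L / halfω₁ L * (a ^ 2 + b ^ 2))) * g (a, b) := by
  have h := (gauge_apply L ((gauge L).symm g) (a, b)).symm
  rw [Equiv.apply_symm_apply] at h
  rw [exp_neg, ← h, inv_mul_cancel_left₀ (exp_ne_zero _)]

lemma exp_mul_exp_mul_exp_mul {p q r s : ℂ} (h : p + q + r = s) (a b : ℂ) :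
    exp p * (exp q * a * (exp r * b)) = exp s * (a * b) := by
  rw [← h, exp_add, exp_add]
  ring

lemma sgn_one : sgn 1 = 1 := by simp [sgn]

lemma sgn_neg_one : sgn (-1) = -1 := by simp [sgn]

lemma sgn_sq (ε : ℤˣ) : sgn ε ^ 2 = 1 := by
  rcases Int.units_eq_one_or ε with rfl | rfl <;> simp [sgn]

variable {L}

lemma sgn_mul_add_sgn_mul_notMem_lattice {a b : ℂ} (hadd : a + b ∉ L.lattice)
    (hsub : a - b ∉ L.lattice) (ε δ : ℤˣ) : sgn ε * a + sgn δ * b ∉ L.lattice := by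
  have hadd' : -a + -b ∉ L.lattice := by rwa [← neg_add, neg_mem_iff]
  have hsub' : -a + b ∉ L.lattice := by rwa [neg_add_eq_sub, ← neg_sub, neg_mem_iff]
  rcases Int.units_eq_one_or ε with rfl | rfl <;> rcases Int.units_eq_one_or δ with rfl | rfl <;>
    simpa only [sgn_one, sgn_neg_one, one_mul, neg_one_mul, ← sub_eq_add_neg]

section

variable (hL : 0 < (ratio L).im)
include hL

lemma theta1_div_ne_zero {z : ℂ} (hz : z ∉ L.lattice) : theta1 (ratio L) (z / L.ω₁) ≠ 0 := by
  obtain ⟨k, hk, h⟩ := exists_theta1_eq_mul_sigma hL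
  rw [h]
  exact mul_ne_zero hk (mul_ne_zero (exp_ne_zero _) (sigma_ne_zero hz))

lemma theta1_sub_div_theta1 (γ z : ℂ) :
    theta1 (ratio L) ((z - γ) / L.ω₁) / theta1 (ratio L) (z / L.ω₁) =
      exp (eta1 L / halfω₁ L * (2 * z * γ - γ ^ 2) / 2) * v L (-γ) z := by
  obtain ⟨k, hk, h⟩ := exists_theta1_eq_mul_sigma hL
  rw [h, h, mul_div_mul_left _ _ hk, mul_div_mul_comm, ← exp_sub, v, ← sub_eq_add_neg]
  ring_nf

lemma prod_theta1_sub_div_theta1 (a b γ : ℂ) :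
    ∏ δ : ℤˣ, theta1 (ratio L) ((a + sgn δ * b - γ) / L.ω₁) /
        theta1 (ratio L) ((a + sgn δ * b) / L.ω₁) =
      exp (eta1 L / halfω₁ L * (2 * a * γ - γ ^ 2)) * (v L (-γ) (a + b) * v L (-γ) (a - b)) := by
  have hexp : eta1 L / halfω₁ L * (2 * a * γ - γ ^ 2) =
      eta1 L / halfω₁ L * (2 * (a + b) * γ - γ ^ 2) / 2 +
        eta1 L / halfω₁ L * (2 * (a - b) * γ - γ ^ 2) / 2 := by ring
  simp only [theta1_sub_div_theta1 hL]
  rw [UnitsInt.univ, Finset.prod_pair (by decide), sgn_one, sgn_neg_one, one_mul, neg_one_mul,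
    ← sub_eq_add_neg, hexp, exp_add, mul_mul_mul_comm]

lemma theta1_sub_div_theta1_add (γ : ℂ) {z : ℂ} (hz : z ∉ L.lattice) :
    theta1 (ratio L) ((z - γ) / L.ω₁) / theta1 (ratio L) ((z + γ) / L.ω₁) =
      exp (eta1 L / halfω₁ L * (2 * z * γ)) * (v L (-γ) z * v L (-γ) (z + γ)) := by
  have hexp : eta1 L / halfω₁ L * (2 * z * γ) =
      eta1 L / halfω₁ L * (2 * z * γ - γ ^ 2) / 2 +
        eta1 L / halfω₁ L * (2 * (z + γ) * γ - γ ^ 2) / 2 := by ring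
  have h := theta1_sub_div_theta1 hL γ (z + γ)
  rw [add_sub_cancel_right] at h
  rw [← div_mul_div_cancel₀ (theta1_div_ne_zero hL hz), theta1_sub_div_theta1 hL, h, hexp, exp_add,
    mul_mul_mul_comm]

lemma theta1_mul_theta1_div_theta1_mul_theta1 (γ z : ℂ) :
    theta1 (ratio L) ((z - γ) / L.ω₁) * theta1 (ratio L) ((z + 2 * γ) / L.ω₁) /
        (theta1 (ratio L) (z / L.ω₁) * theta1 (ratio L) ((z + γ) / L.ω₁)) =
      exp (-(2 * (eta1 L / halfω₁ L) * γ ^ 2)) * (v L (-γ) z * v L (-γ) (-z - γ)) := by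
  have hexp : -(2 * (eta1 L / halfω₁ L) * γ ^ 2) =
      eta1 L / halfω₁ L * (2 * z * γ - γ ^ 2) / 2 +
        eta1 L / halfω₁ L * (2 * (-z - γ) * γ - γ ^ 2) / 2 := by ring
  have hneg : theta1 (ratio L) ((z + 2 * γ) / L.ω₁) / theta1 (ratio L) ((z + γ) / L.ω₁) =
      theta1 (ratio L) ((-z - γ - γ) / L.ω₁) / theta1 (ratio L) ((-z - γ) / L.ω₁) := by
    rw [← neg_div_neg_eq, ← theta1_neg, ← theta1_neg]
    ring_nf
  rw [mul_div_mul_comm, hneg, theta1_sub_div_theta1 hL, theta1_sub_div_theta1 hL, hexp, exp_add,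
    mul_mul_mul_comm]

lemma gauge_M1 (γ : ℂ) (g : ℂ × ℂ → ℂ) (x : ℂ × ℂ) :
    gauge L (M1 (ratio L) (γ / L.ω₁) ((gauge L).symm g)) x =
      exp (-(2 * (eta1 L / halfω₁ L) * γ ^ 2)) * H1bar L γ g x := by
  simp only [gauge_apply, H1bar_eq, M1, mul_add (exp _), Finset.mul_sum, ← mul_div_assoc, ← add_div,
    ← sub_div, gauge_symm_apply, prod_theta1_sub_div_theta1 hL]
  congr 1 <;> refine Finset.sum_congr rfl fun ε _ ↦ exp_mul_exp_mul_exp_mul ?_ _ _ <;>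
    linear_combination -(eta1 L / halfω₁ L * γ ^ 2) * sgn_sq ε

lemma gauge_M2 (γ : ℂ) (g : ℂ × ℂ → ℂ) {x : ℂ × ℂ} (hadd : x.1 + x.2 ∉ L.lattice)
    (hsub : x.1 - x.2 ∉ L.lattice) :
    gauge L (M2 (ratio L) (γ / L.ω₁) ((gauge L).symm g)) x =
      exp (-(2 * (eta1 L / halfω₁ L) * γ ^ 2)) * (H2bar L γ g x + 2 * H1bar L γ g x) := by
  simp only [gauge_apply, H2bar_add_two_mul_H1bar, M2, Finset.mul_sum, ← mul_div_assoc, ← add_div,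
    ← sub_div, gauge_symm_apply]
  refine Finset.sum_congr rfl fun ε _ ↦ Finset.sum_congr rfl fun δ _ ↦ ?_
  rw [mul_add (exp _), mul_add (exp _), theta1_mul_theta1_div_theta1_mul_theta1 hL,
    theta1_sub_div_theta1_add hL γ (sgn_mul_add_sgn_mul_notMem_lattice hadd hsub ε δ)]
  congr 1 <;> refine exp_mul_exp_mul_exp_mul ?_ _ _
  · linear_combination -(eta1 L / halfω₁ L * γ ^ 2) * (sgn_sq ε + sgn_sq δ)
  · ring

end

end EllipticC2

end

open EllipticC2 in
theorem theorem2 (L : PeriodPair) (hτ : 0 < (halfω₂ L / halfω₁ L).im) (h γ : ℂ)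
    (hγ : γ = 2 * halfω₁ L * h) :
    (∀ (g : ℂ × ℂ → ℂ) (x : ℂ × ℂ), x.1 + x.2 ∉ L.lattice → x.1 - x.2 ∉ L.lattice →
      gauge L (M1 (halfω₂ L / halfω₁ L) h ((gauge L).symm g)) x =
        Complex.exp (-(2 * eta1 L * γ ^ 2 / halfω₁ L)) * H1bar L γ g x) ∧
    (∀ (g : ℂ × ℂ → ℂ) (x : ℂ × ℂ),
      (∀ z ∈ ({x.1 + x.2, x.1 - x.2} : Set ℂ),
        z ∉ L.lattice ∧ z + γ ∉ L.lattice ∧ z - γ ∉ L.lattice) →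
      gauge L (M2 (halfω₂ L / halfω₁ L) h ((gauge L).symm g)) x =
        Complex.exp (-(2 * eta1 L * γ ^ 2 / halfω₁ L)) *
          (H2bar L γ g x + 2 * H1bar L γ g x)) := by
  rw [halfω₂_div_halfω₁] at hτ ⊢
  have hh : h = γ / L.ω₁ := by
    rw [hγ, two_mul_halfω₁, mul_div_cancel_left₀ _ (ω₁_ne_zero L)]
  have hA : 2 * eta1 L * γ ^ 2 / halfω₁ L = 2 * (eta1 L / halfω₁ L) * γ ^ 2 := by ring
  rw [hh, hA]
  exact ⟨fun g x _ _ ↦ gauge_M1 hτ γ g x,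
    fun g x hx ↦ gauge_M2 hτ γ g (hx _ (by simp)).1 (hx _ (by simp)).1⟩
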